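/- Let $N$ be a topological $4$-manifold (possibly with boundary) and let \[ D=(D_1,\dots,D_m)\colon (D^2\sqcup\dots\sqcup D^2,\,S^1\sqcup\dots\sqcup S^1)\to (N,\partial N) \] be a proper generic immersion of discs (only boundary points are sent to $\partial N$; locally flat, with finitely many transverse double points, in the interior) that admits a geometrically dual, generically immersed collection $\{E_i\}_{i=1}^m$ of framed spheres in $N$; that is, $E_i$ meets $D_i$ transversely in exactly one point and $E_i\cap D_j=\emptyset$ for $i\neq j$. Fix a framed normal bundle of the generic immersion $D\sqcup E$, i.e. a trivial plane bundle whose total space is mapped to $N$ by a local homeomorphism that is an embedding apart from one plumbing at each double point, and let $\nu D_i$ be the image of the open unit disc bundle over $D_i$. Let $\Sigma^c\subset N\setminus\bigcup_{i=1}^m\nu D_i$ be a capped surface constructed as follows. The body is a Clifford torus corresponding to an intersection point between $D_i$ and $D_j$, where $i=j$ is permitted: in plumbing coordinates $\mathbb R^2\times\mathbb R^2$ around the intersection point, in which the two sheets are $\mathbb R^2\times 0$ and $0\times\mathbb R^2$, it is $\{|x|=|y|=r\}$ with $r\ge 1$. The two caps, attached along the curves $\{x_0\}\times\{|y|=r\}$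 and $\{|x|=r\}\times\{y_0\}$, are obtained from the meridional discs $\{x_0\}\times\{|y|\le r\}$ for $D_i$ and $\{|x|\le r\}\times\{y_0\}$ for $D_j$ by tubing their intersection points with $D_i$ and $D_j$, along arcs in $D_i$ and $D_j$, into parallel copies of $E_i$ and $E_j$ respectively. Let $S\colon S^2\to N\setminus\bigcup_{i=1}^m\nu D_i$ be the $2$-sphere obtained by (symmetric) contraction of $\Sigma^c$: the union of the complement in the torus of two bands around the two attaching curves, the small square in which these bands cross, and two parallel copies of each cap. Let $\iota\colon N\setminus\bigcup_{i=1}^m\nu D_i\to N$ be the inclusion map. Then $\iota_*[S]=0\in\pi_2(N)$, for every choice of base point and of path from it to $S$; equivalently, $\iota\circ S$ is null-homotopic. -/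

import Mathlib

open scoped Manifold unitInterval Topology

namespace CappedSurface

noncomputable section

/-! ### Spheres and the second homotopy group -/

/-- The closed unit disc `D²`. -/
abbrev Disc : Type := Metric.closedBall (0 : ℂ) 1

/-- The round unit sphere `S²`. -/
abbrev Sphere : Type := Metric.sphere (0 : EuclideanSpace ℝ (Fin 3)) 1

/-- The interval `[-1, 1]`, in which parallel copies are indexed. -/
abbrev Par : Type := Set.Icc (-1 : ℝ) 1

/-- Nearest point retraction of `ℝ` onto `[-1, 1]`. -/
def toPar (t : ℝ) : Par := Set.projIcc (-1) 1 (by norm_num) t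

/-- The north pole `(0, 0, 1)`, the base point of `S²`. -/
def north : Sphere := ⟨EuclideanSpace.single 2 1, by simp⟩

/-- The collapse `[-1,1]² → S²` of the boundary of the square to the north pole. It is the
homeomorphism `(x, y) ↦ v = (x √(1 - y²/2), y √(1 - x²/2))` from the square to the unit disc,
followed by `v ↦ (2 √(1 - |v|²) v, 2 |v|² - 1)`; here `1 - |v|² = (1 - x²)(1 - y²)`. -/
def collapse (x y : Par) : Sphere :=
  ⟨!₂[2 * √((1 - (x : ℝ) ^ 2) * (1 - (y : ℝ) ^ 2)) * (x * √(1 - (y : ℝ) ^ 2 / 2)),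
      2 * √((1 - (x : ℝ) ^ 2) * (1 - (y : ℝ) ^ 2)) * (y * √(1 - (x : ℝ) ^ 2 / 2)),
      1 - 2 * ((1 - (x : ℝ) ^ 2) * (1 - (y : ℝ) ^ 2))], by
    have hx : (x : ℝ) ^ 2 ≤ 1 := by
      have := x.2.1; have := x.2.2; nlinarith
    have hy : (y : ℝ) ^ 2 ≤ 1 := by
      have := y.2.1; have := y.2.2; nlinarith
    have h1 := Real.sq_sqrt (mul_nonneg (sub_nonneg.2 hx) (sub_nonneg.2 hy))
    have h2 : √(1 - (y : ℝ) ^ 2 / 2) ^ 2 = 1 - (y : ℝ) ^ 2 / 2 :=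
      Real.sq_sqrt (by linarith)
    have h3 : √(1 - (x : ℝ) ^ 2 / 2) ^ 2 = 1 - (x : ℝ) ^ 2 / 2 :=
      Real.sq_sqrt (by linarith)
    rw [mem_sphere_zero_iff_norm, EuclideanSpace.norm_eq, Real.sqrt_eq_one]
    simp only [Fin.sum_univ_three, Real.norm_eq_abs, sq_abs]
    simp only [Matrix.cons_val_zero, Matrix.cons_val_one, Matrix.cons_val]
    simp only [mul_pow, h1, h2, h3]
    ring⟩

theorem collapse_continuous : Continuous fun p : Par × Par => collapse p.1 p.2 := by
  unfold collapse
  refine Continuous.subtype_mk ?_ _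
  refine (PiLp.continuous_toLp 2 _).comp (continuous_pi fun i => ?_)
  fin_cases i <;> simp <;> fun_prop

theorem collapse_boundary {x y : Par} (h : |(x : ℝ)| = 1 ∨ |(y : ℝ)| = 1) :
    collapse x y = north := by
  have h0 : (1 - (x : ℝ) ^ 2) * (1 - (y : ℝ) ^ 2) = 0 := by
    rcases h with h | h
    · rw [← sq_abs (x : ℝ), h]; simp
    · rw [← sq_abs (y : ℝ), h]; simp
  apply Subtype.ext
  ext i
  fin_cases i <;> simp [collapse, north, h0]

variable {X Y : Type*} [TopologicalSpace X] [TopologicalSpace Y]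

theorem toPar_continuous : Continuous toPar :=
  continuous_projIcc (h := by norm_num)

theorem toPar_coe {t : ℝ} (h : |t| ≤ 1) : (toPar t : ℝ) = t := by
  rw [toPar, Set.projIcc_of_mem _ (Set.mem_Icc.2 (abs_le.1 h))]

/-- Coordinates in `[-1, 1]` on the unit square. -/
def sqCoord (c : Fin 2 → I) (k : Fin 2) : ℝ := 2 * (c k : ℝ) - 1

/-- The distance of a point of the square from the centre, in the supremum norm. -/
def sqRadius (c : Fin 2 → I) : ℝ := max |sqCoord c 0| |sqCoord c 1|

theorem sqCoord_continuous (k : Fin 2) : Continuous fun c => sqCoord c k :=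
  (continuous_const.mul (continuous_subtype_val.comp (continuous_apply k))).sub continuous_const

theorem sqRadius_continuous : Continuous sqRadius :=
  (sqCoord_continuous 0).abs.max (sqCoord_continuous 1).abs

theorem sqRadius_boundary {c : Fin 2 → I} (h : c ∈ Cube.boundary (Fin 2)) : sqRadius c = 1 := by
  obtain ⟨k, hk⟩ := h
  have b : ∀ i, |sqCoord c i| ≤ 1 := fun i => by
    have := (c i).2.1; have := (c i).2.2
    rw [sqCoord, abs_le]; constructor <;> linarith
  have e : |sqCoord c k| = 1 := by
    rw [sqCoord]
    rcases hk with h | h <;> rw [h] <;> norm_num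
  apply le_antisymm (max_le (b 0) (b 1))
  fin_cases k
  · exact e.ge.trans (le_max_left _ _)
  · exact e.ge.trans (le_max_right _ _)

/-- The map underlying `sphereLoop`. -/
def sphereLoopFun (S : C(Sphere, X)) {x₀ : X} (w : Path x₀ (S north)) (c : Fin 2 → I) : X :=
  if sqRadius c ≤ 1 / 2 then S (collapse (toPar (2 * sqCoord c 0)) (toPar (2 * sqCoord c 1)))
  else w.extend (2 - 2 * sqRadius c)

theorem sphereLoopFun_continuous (S : C(Sphere, X)) {x₀ : X} (w : Path x₀ (S north)) :
    Continuous (sphereLoopFun S w) := by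
  refine Continuous.if_le ?_ ?_ sqRadius_continuous continuous_const ?_
  · refine S.continuous.comp (collapse_continuous.comp (g := fun p : Par × Par => _)
      (f := fun c => (toPar (2 * sqCoord c 0), toPar (2 * sqCoord c 1))) ?_)
    exact (toPar_continuous.comp (continuous_const.mul (sqCoord_continuous 0))).prodMk
      (toPar_continuous.comp (continuous_const.mul (sqCoord_continuous 1)))
  · exact w.continuous_extend.comp (continuous_const.sub (continuous_const.mul sqRadius_continuous))
  · intro c hc
    have h0 : |sqCoord c 0| ≤ 1 / 2 := (le_max_left _ _).trans hc.le
    have h1 : |sqCoord c 1| ≤ 1 / 2 := (le_max_right _ _).trans hc.le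
    have e : collapse (toPar (2 * sqCoord c 0)) (toPar (2 * sqCoord c 1)) = north := by
      apply collapse_boundary
      rw [toPar_coe (by rw [abs_mul, abs_two]; linarith),
        toPar_coe (by rw [abs_mul, abs_two]; linarith), abs_mul, abs_mul, abs_two]
      rw [sqRadius] at hc
      rcases max_choice |sqCoord c 0| |sqCoord c 1| with h | h
      · left; linarith
      · right; linarith
    rw [e, hc]
    norm_num

/-- The based loop `(I², ∂I²) → (X, x₀)` of a map `S : S² → X` with a whisker `w` from `x₀` to the
image of the base point of `S²`: on the inner half-size square use `S`, outside run along `w`. -/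
def sphereLoop (S : C(Sphere, X)) {x₀ : X} (w : Path x₀ (S north)) : GenLoop (Fin 2) X x₀ :=
  ⟨⟨sphereLoopFun S w, sphereLoopFun_continuous S w⟩, fun c hc => by
    simp only [ContinuousMap.coe_mk, sphereLoopFun, sqRadius_boundary hc]
    norm_num⟩

/-- The element `[S] ∈ π₂(X, x₀)` of a whiskered sphere. -/
def sphereClass (S : C(Sphere, X)) {x₀ : X} (w : Path x₀ (S north)) : π_ 2 X x₀ :=
  Quotient.mk _ (sphereLoop S w)

/-- The map `φ_* : π_n(X, x) → π_n(Y, φ x)` induced by `φ : X → Y`. -/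
def inducedMap (φ : C(X, Y)) (n : ℕ) (x : X) : π_ n X x → π_ n Y (φ x) :=
  Quotient.map (fun f => ⟨φ.comp f.1, fun c hc => congrArg φ (f.2 c hc)⟩)
    (fun _ _ h => h.map fun H => H.compContinuousMap φ)

/-! ### Capped tori and their contraction -/

/-- The radial retraction of the plane onto the closed unit disc. -/
def toDisc (z : ℂ) : Disc :=
  ⟨z / (max 1 ‖z‖ : ℝ), by
    have h : 0 < max 1 ‖z‖ := lt_max_of_lt_left one_pos
    rw [mem_closedBall_zero_iff, norm_div, Complex.norm_real, Real.norm_of_nonneg h.le,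
      div_le_one h]
    exact le_max_right _ _⟩

theorem toDisc_continuous : Continuous toDisc := by
  refine Continuous.subtype_mk (Continuous.div continuous_id (by fun_prop) fun z => ?_) _
  exact_mod_cast (lt_max_of_lt_left one_pos : 0 < max 1 ‖z‖).ne'

theorem toDisc_coe {z : ℂ} (h : ‖z‖ ≤ 1) : (toDisc z : ℂ) = z := by
  simp [toDisc, max_eq_left h]

/-- A point of the boundary circle, as a point of the disc. -/
def circleToDisc (ξ : Circle) : Disc := ⟨ξ, by rw [mem_closedBall_zero_iff, Circle.norm_coe]⟩

theorem toDisc_circle (ξ : Circle) : toDisc (ξ : ℂ) = circleToDisc ξ :=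
  Subtype.ext (toDisc_coe (Circle.norm_coe ξ).le)

/-- A torus in `X` with caps attached along the dual curves `{base₁} × S¹` and `S¹ × {base₂}`.
Each cap comes with its parallel copies, indexed by `t ∈ [-1, 1]`, the cap itself being the copy
`t = 0`; the boundaries of the copies are parallel copies, in the torus, of the boundary curve of
the cap, filling a closed annulus. -/
structure CappedTorus (X : Type*) [TopologicalSpace X] where
  body : C(Circle × Circle, X)
  base₁ : Circle
  base₂ : Circle
  width₁ : ℝ
  width₂ : ℝ
  width₁_mem : width₁ ∈ Set.Ioo 0 Real.pi
  width₂_mem : width₂ ∈ Set.Ioo 0 Real.pi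
  cap₁ : C(Disc × Par, X)
  cap₂ : C(Disc × Par, X)
  cap₁_boundary : ∀ (ξ : Circle) (t : Par),
    cap₁ (circleToDisc ξ, t) = body (base₁ * Circle.exp (width₁ * t), ξ)
  cap₂_boundary : ∀ (ζ : Circle) (t : Par),
    cap₂ (circleToDisc ζ, t) = body (ζ, base₂ * Circle.exp (width₂ * t))

/-- For `y ∈ [-1, 1]`, the point at angle `π - (π - δ) y`. As `y` runs from `1` to `-1` this runs
from angle `δ` to angle `2 π - δ`, through the arc complementary to `{e^{iδy}}`. -/
def farArc (δ y : ℝ) : Circle := Circle.exp (Real.pi - (Real.pi - δ) * y)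

/-- The identification of the square `[-1,1]²`, with the edges `y = 1` and `y = -1` collapsed to
points, with the unit disc: `z = -1` goes to the arc `{b e^{iδy}}`, `z = 1` goes to the
complementary arc of the unit circle, and for each `y` the segment between is a chord. (The
argument of `toDisc` lies in the unit disc.) -/
def bigon (b : Circle) (δ y z : ℝ) : Disc :=
  toDisc (b * (((1 - z) / 2 : ℝ) * Circle.exp (δ * y) + ((1 + z) / 2 : ℝ) * farArc δ y))

/-- The surface of the cube `[-1,1]³`, as a set in `ℝ³ ∖ 0`, is identified with `S²` by radial
projection; `cubeCoord p k` is the `k`-th coordinate of the point of the cube surface on the ray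
through `p`. -/
def cubeCoord (p : Sphere) (k : Fin 3) : ℝ := p.1 k / max |p.1 0| (max |p.1 1| |p.1 2|)

theorem farArc_eq {δ y : ℝ} (h : |y| = 1) :
    farArc δ y = Circle.exp (δ * y) := by
  rcases (abs_eq zero_le_one).1 h with rfl | rfl
  · simp [farArc]
  · have : Real.pi - (Real.pi - δ) * -1 = δ * -1 + 2 * Real.pi := by ring
    rw [farArc, this, Circle.exp_add_two_pi]

theorem bigon_near (b : Circle) (δ y : ℝ) :
    bigon b δ y (-1) = circleToDisc (b * Circle.exp (δ * y)) := by
  rw [← toDisc_circle, bigon]; norm_num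

theorem bigon_far (b : Circle) (δ y : ℝ) :
    bigon b δ y 1 = circleToDisc (b * farArc δ y) := by
  rw [← toDisc_circle, bigon]; norm_num

theorem bigon_vertex (b : Circle) (δ : ℝ) {y : ℝ} (z : ℝ) (h : |y| = 1) :
    bigon b δ y z = circleToDisc (b * Circle.exp (δ * y)) := by
  rw [← toDisc_circle, bigon, farArc_eq h, ← add_mul, ← Complex.ofReal_add, Circle.coe_mul]
  congr 2
  rw [show (1 - z) / 2 + (1 + z) / 2 = 1 by ring]
  simp

theorem cubeNorm_pos (p : Sphere) :
    0 < max |p.1 0| (max |p.1 1| |p.1 2|) := by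
  by_contra h
  have h := not_lt.1 h
  have h0 := abs_nonpos_iff.1 ((le_max_left _ _).trans h)
  have h1 := abs_nonpos_iff.1 (((le_max_left _ _).trans (le_max_right _ _)).trans h)
  have h2 := abs_nonpos_iff.1 (((le_max_right _ _).trans (le_max_right _ _)).trans h)
  have : p.1 = 0 := by
    ext i
    fin_cases i <;> assumption
  have hp := p.2
  rw [mem_sphere_zero_iff_norm, this, norm_zero] at hp
  exact zero_ne_one hp

theorem cubeCoord_continuous (k : Fin 3) :
    Continuous fun p => cubeCoord p k := by
  have c : ∀ i : Fin 3, Continuous fun p : Sphere => p.1 i := fun i =>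
    (EuclideanSpace.proj (𝕜 := ℝ) i).continuous.comp continuous_subtype_val
  exact (c k).div ((c 0).abs.max ((c 1).abs.max (c 2).abs)) fun p => (cubeNorm_pos p).ne'

theorem cubeCoord_norm (p : Sphere) :
    max |cubeCoord p 0| (max |cubeCoord p 1| |cubeCoord p 2|) = 1 := by
  have h := cubeNorm_pos p
  simp only [cubeCoord, abs_div, abs_of_pos h]
  rw [max_div_div_right h.le, max_div_div_right h.le, div_self h.ne']

theorem bigon_continuous (b : Circle) (δ : ℝ) : Continuous fun q : ℝ × ℝ => bigon b δ q.1 q.2 := by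
  have e : Continuous fun t : ℝ => (Circle.exp t : ℂ) :=
    continuous_subtype_val.comp Circle.exp.continuous
  refine toDisc_continuous.comp (continuous_const.mul (Continuous.add ?_ ?_))
  · exact Continuous.mul (Complex.continuous_ofReal.comp (by fun_prop)) (e.comp (by fun_prop))
  · exact Continuous.mul (Complex.continuous_ofReal.comp (by fun_prop)) (e.comp (by fun_prop))

namespace CappedTorus

variable (K : CappedTorus X)

/-- The part of the contraction on the bottom face: the small square where the two bands of
parallel curves cross. -/
def nearSquare (x y : ℝ) : X :=
  K.body (K.base₁ * Circle.exp (K.width₁ * x), K.base₂ * Circle.exp (K.width₂ * y))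

/-- The part of the contraction on the top face: the complement in the torus of the two bands. -/
def farSquare (x y : ℝ) : X :=
  K.body (K.base₁ * farArc K.width₁ x, K.base₂ * farArc K.width₂ y)

/-- The part of the contraction on the faces `x = ±1`: two parallel copies of the first cap. -/
def capFace₁ (x y z : ℝ) : X := K.cap₁ (bigon K.base₂ K.width₂ y z, toPar x)

/-- The part of the contraction on the faces `y = ±1`: two parallel copies of the second cap. -/
def capFace₂ (x y z : ℝ) : X := K.cap₂ (bigon K.base₁ K.width₁ x z, toPar y)

/-- The (symmetric) contraction, on the surface of the cube `[-1,1]³`. -/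
def cubeContraction (x y z : ℝ) : X :=
  if max |x| |y| ≤ -z then K.nearSquare x y
  else if max |x| |y| ≤ z then K.farSquare x y
  else if |y| ≤ |x| then K.capFace₁ x y z
  else K.capFace₂ x y z

theorem capFace₁_near {x : ℝ} (y : ℝ) (hx : |x| = 1) :
    K.capFace₁ x y (-1) = K.nearSquare x y := by
  rw [capFace₁, bigon_near, K.cap₁_boundary, toPar_coe hx.le, nearSquare]

theorem capFace₂_near (x : ℝ) {y : ℝ} (hy : |y| = 1) :
    K.capFace₂ x y (-1) = K.nearSquare x y := by
  rw [capFace₂, bigon_near, K.cap₂_boundary, toPar_coe hy.le, nearSquare]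

theorem capFace₁_far {x : ℝ} (y : ℝ) (hx : |x| = 1) :
    K.capFace₁ x y 1 = K.farSquare x y := by
  rw [capFace₁, bigon_far, K.cap₁_boundary, toPar_coe hx.le, farSquare, farArc_eq hx]

theorem capFace₂_far (x : ℝ) {y : ℝ} (hy : |y| = 1) :
    K.capFace₂ x y 1 = K.farSquare x y := by
  rw [capFace₂, bigon_far, K.cap₂_boundary, toPar_coe hy.le, farSquare, farArc_eq hy]

theorem capFace₁_eq_capFace₂ {x y : ℝ} (z : ℝ) (hx : |x| = 1) (hy : |y| = 1) :
    K.capFace₁ x y z = K.capFace₂ x y z := by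
  rw [capFace₁, capFace₂, bigon_vertex _ _ _ hx, bigon_vertex _ _ _ hy, K.cap₁_boundary,
    K.cap₂_boundary, toPar_coe hx.le, toPar_coe hy.le]

/-- The pieces of the contraction agree along all edges of the cube. -/
theorem cubeContraction_eq {x y z : ℝ} (h : max |x| (max |y| |z|) = 1) :
    (max |x| |y| ≤ -z → K.cubeContraction x y z = K.nearSquare x y) ∧
    (max |x| |y| ≤ z → K.cubeContraction x y z = K.farSquare x y) ∧
    (|y| ≤ |x| ∧ |z| ≤ |x| → K.cubeContraction x y z = K.capFace₁ x y z) ∧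
    (|x| ≤ |y| ∧ |z| ≤ |y| → K.cubeContraction x y z = K.capFace₂ x y z) := by
  have nx := abs_nonneg x
  have ny := abs_nonneg y
  have nz := abs_nonneg z
  have ex : |y| ≤ |x| → |z| ≤ |x| → |x| = 1 := fun h1 h2 => by
    rwa [max_eq_left (max_le h1 h2)] at h
  have ey : |x| ≤ |y| → |z| ≤ |y| → |y| = 1 := fun h1 h2 => by
    rwa [max_eq_left h2, max_eq_right h1] at h
  refine ⟨fun h1 => if_pos h1, fun h1 => ?_, fun ⟨h1, h2⟩ => ?_, fun ⟨h1, h2⟩ => ?_⟩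
  · rw [cubeContraction, if_neg, if_pos h1]
    intro h0
    have a1 := (le_max_left _ _).trans h0
    have a2 := (le_max_left _ _).trans h1
    have a3 := (le_max_right _ _).trans h1
    have hz : z = 0 := by linarith
    rw [hz] at a2 a3
    rw [hz, le_antisymm a2 nx, le_antisymm a3 ny] at h
    simp at h
  · have e := ex h1 h2
    rw [cubeContraction]
    split_ifs with i1 i2
    · have : z = -1 := by
        have := (le_max_left _ _).trans i1
        have := neg_abs_le z
        linarith
      rw [this, K.capFace₁_near y e]
    · have : z = 1 := by
        have := (le_max_left _ _).trans i2
        have := le_abs_self z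
        linarith
      rw [this, K.capFace₁_far y e]
    · rfl
  · have e := ey h1 h2
    rw [cubeContraction]
    split_ifs with i1 i2 i3
    · have : z = -1 := by
        have := (le_max_right _ _).trans i1
        have := neg_abs_le z
        linarith
      rw [this, K.capFace₂_near x e]
    · have : z = 1 := by
        have := (le_max_right _ _).trans i2
        have := le_abs_self z
        linarith
      rw [this, K.capFace₂_far x e]
    · exact K.capFace₁_eq_capFace₂ z (by linarith) e
    · rfl

theorem contraction_continuous :
    Continuous fun p => K.cubeContraction (cubeCoord p 0) (cubeCoord p 1) (cubeCoord p 2) := by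
  have c := cubeCoord_continuous
  have c0 := c 0
  have c1 := c 1
  have c2 := c 2
  have ex := Circle.exp.continuous
  have cn : Continuous fun p => K.nearSquare (cubeCoord p 0) (cubeCoord p 1) :=
    K.body.continuous.comp
      ((continuous_const.mul (ex.comp (continuous_const.mul c0))).prodMk
        (continuous_const.mul (ex.comp (continuous_const.mul c1))))
  have cf : Continuous fun p => K.farSquare (cubeCoord p 0) (cubeCoord p 1) :=
    K.body.continuous.comp
      ((continuous_const.mul (ex.comp (continuous_const.sub (continuous_const.mul c0)))).prodMk
        (continuous_const.mul (ex.comp (continuous_const.sub (continuous_const.mul c1)))))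
  have c₁ : Continuous fun p => K.capFace₁ (cubeCoord p 0) (cubeCoord p 1) (cubeCoord p 2) :=
    K.cap₁.continuous.comp (((bigon_continuous _ _).comp (c1.prodMk c2)).prodMk
      (toPar_continuous.comp c0))
  have c₂ : Continuous fun p => K.capFace₂ (cubeCoord p 0) (cubeCoord p 1) (cubeCoord p 2) :=
    K.cap₂.continuous.comp (((bigon_continuous _ _).comp (c0.prodMk c2)).prodMk
      (toPar_continuous.comp c1))
  have key := fun p => K.cubeContraction_eq (cubeCoord_norm p)
  let F : Fin 4 → Set Sphere :=
    ![{p | max |cubeCoord p 0| |cubeCoord p 1| ≤ -cubeCoord p 2},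
      {p | max |cubeCoord p 0| |cubeCoord p 1| ≤ cubeCoord p 2},
      {p | |cubeCoord p 1| ≤ |cubeCoord p 0| ∧ |cubeCoord p 2| ≤ |cubeCoord p 0|},
      {p | |cubeCoord p 0| ≤ |cubeCoord p 1| ∧ |cubeCoord p 2| ≤ |cubeCoord p 1|}]
  refine (locallyFinite_of_finite F).continuous ?_ ?_ ?_
  · refine Set.eq_univ_of_forall fun p => Set.mem_iUnion.2 ?_
    rcases le_total |cubeCoord p 0| |cubeCoord p 1| with h | h
    · rcases le_total |cubeCoord p 2| |cubeCoord p 1| with h' | h'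
      · exact ⟨3, h, h'⟩
      · rcases abs_choice (cubeCoord p 2) with e | e
        · exact ⟨1, max_le (h.trans (h'.trans e.le)) (h'.trans e.le)⟩
        · exact ⟨0, max_le (h.trans (h'.trans e.le)) (h'.trans e.le)⟩
    · rcases le_total |cubeCoord p 2| |cubeCoord p 0| with h' | h'
      · exact ⟨2, h, h'⟩
      · rcases abs_choice (cubeCoord p 2) with e | e
        · exact ⟨1, max_le (h'.trans e.le) (h.trans (h'.trans e.le))⟩
        · exact ⟨0, max_le (h'.trans e.le) (h.trans (h'.trans e.le))⟩
  · intro i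
    fin_cases i
    · exact isClosed_le (c0.abs.max c1.abs) c2.neg
    · exact isClosed_le (c0.abs.max c1.abs) c2
    · exact (isClosed_le c1.abs c0.abs).inter (isClosed_le c2.abs c0.abs)
    · exact (isClosed_le c0.abs c1.abs).inter (isClosed_le c2.abs c1.abs)
  · intro i
    fin_cases i
    · exact cn.continuousOn.congr fun p hp => (key p).1 hp
    · exact cf.continuousOn.congr fun p hp => (key p).2.1 hp
    · exact c₁.continuousOn.congr fun p hp => (key p).2.2.1 hp
    · exact c₂.continuousOn.congr fun p hp => (key p).2.2.2 hp

/-- The 2-sphere obtained by (symmetric) contraction of a capped torus: the complement in the torus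
of the two bands of parallel curves, the small square where these bands cross, and two parallel
copies of each cap. -/
def contraction : C(Sphere, X) :=
  ⟨fun p => K.cubeContraction (cubeCoord p 0) (cubeCoord p 1) (cubeCoord p 2),
    K.contraction_continuous⟩

end CappedTorus

/-! ### Generic immersions and their normal bundles -/

/-- The closed upper half-plane. -/
abbrev HalfPlane : Type := {z : ℂ // 0 ≤ z.im}

/-- A proper generic immersion of a (possibly disconnected) surface `F` with boundary `bd` in a
topological 4-manifold `N`: only boundary points go to `∂N`; there are finitely many double points,
all of them in the interior; and in suitable coordinates, whose domain in `N` contains no other part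
of the image, the map is `ℝ² × 0 ⊂ ℝ⁴` near an interior point with a single inverse image,
`ℝ² × 0 ∪ 0 × ℝ² ⊂ ℝ⁴` near a double point, and `H² × 0 ⊂ H² × ℝ²` near a boundary point. -/
structure IsGenericImmersion {N F : Type*} [TopologicalSpace N]
    [ChartedSpace (EuclideanHalfSpace 4) N] [TopologicalSpace F] (bd : Set F) (f : F → N) :
    Prop where
  continuous : Continuous f
  preimage_boundary : f ⁻¹' (𝓡∂ 4).boundary N = bd
  finite_double : {s | ∃ t, t ≠ s ∧ f t = f s}.Finite
  flat : ∀ s ∉ bd, (∀ t, f t = f s → t = s) →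
    ∃ (φ : OpenPartialHomeomorph N (ℂ × ℂ)) (ψ : OpenPartialHomeomorph F ℂ),
      φ.target = Set.univ ∧ ψ.target = Set.univ ∧ s ∈ ψ.source ∧
      f ⁻¹' φ.source = ψ.source ∧ ∀ x ∈ ψ.source, φ (f x) = (ψ x, 0)
  transverse : ∀ s t, s ≠ t → f s = f t →
    ∃ (φ : OpenPartialHomeomorph N (ℂ × ℂ)) (ψ ψ' : OpenPartialHomeomorph F ℂ),
      φ.target = Set.univ ∧ ψ.target = Set.univ ∧ ψ'.target = Set.univ ∧
      s ∈ ψ.source ∧ t ∈ ψ'.source ∧ f ⁻¹' φ.source = ψ.source ∪ ψ'.source ∧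
      (∀ x ∈ ψ.source, φ (f x) = (ψ x, 0)) ∧ ∀ x ∈ ψ'.source, φ (f x) = (0, ψ' x)
  flat_boundary : ∀ s ∈ bd,
    ∃ (φ : OpenPartialHomeomorph N (HalfPlane × ℂ)) (ψ : OpenPartialHomeomorph F HalfPlane),
      φ.target = Set.univ ∧ ψ.target = Set.univ ∧ s ∈ ψ.source ∧
      f ⁻¹' φ.source = ψ.source ∧ ∀ x ∈ ψ.source, φ (f x) = (ψ x, 0)

/-- A plumbing of the thickening `map : F × ℝ² → N` of a surface at an intersection of the sheets
through `s` and `t`: there are coordinate discs `u` and `v` in `F` around `s` and `t` over which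
`map` identifies the two copies of `ℝ² × ℝ²`, interchanging the base and the fibre directions. -/
structure Plumbing {N F : Type*} [TopologicalSpace F] (map : F × ℂ → N) (s t : F) where
  u : ℂ → F
  v : ℂ → F
  u_embedding : Topology.IsOpenEmbedding u
  v_embedding : Topology.IsOpenEmbedding v
  u_zero : u 0 = s
  v_zero : v 0 = t
  disjoint : Disjoint (Set.range u) (Set.range v)
  plumb : ∀ x y, map (u x, y) = map (v y, x)

/-- The same plumbing, with the roles of the two sheets interchanged. -/
def Plumbing.swap {N F : Type*} [TopologicalSpace F] {map : F × ℂ → N} {s t : F}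
    (P : Plumbing map s t) : Plumbing map t s where
  u := P.v
  v := P.u
  u_embedding := P.v_embedding
  v_embedding := P.u_embedding
  u_zero := P.v_zero
  v_zero := P.u_zero
  disjoint := P.disjoint.symm
  plumb x y := (P.plumb y x).symm

/-- A framed normal bundle of a generic immersion `f : F → N`: a map to `N` from the total space
`F × ℝ²` of the trivial bundle, extending `f` on the zero section, which is a local homeomorphism
and which is an embedding apart from one plumbing at each double point of `f`. -/
structure FramedNormalBundle {N F : Type*} [TopologicalSpace N]
    [ChartedSpace (EuclideanHalfSpace 4) N] [TopologicalSpace F] (bd : Set F) (f : F → N) where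
  map : F × ℂ → N
  isLocalHomeomorph : IsLocalHomeomorph map
  map_zero : ∀ s, map (s, 0) = f s
  map_boundary : ∀ s y, map (s, y) ∈ (𝓡∂ 4).boundary N ↔ s ∈ bd
  nonempty_plumbing : ∀ s t, s ≠ t → f s = f t → Nonempty (Plumbing map s t)
  eq_or_plumbed : ∀ p q, map p = map q → p = q ∨
    ∃ (s t : F) (P : Plumbing map s t) (x y : ℂ), p = (P.u x, y) ∧ q = (P.v y, x)
  encard_preimage_le : ∀ p : N, (map ⁻¹' {p}).encard ≤ 2

/-! ### Discs, dual spheres and Clifford tori -/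

/-- The disjoint union of `m` discs and `m` spheres. -/
abbrev DiscsSpheres (m : ℕ) : Type := (Fin m × Disc) ⊕ (Fin m × Sphere)

/-- The boundary of the disjoint union of `m` discs and `m` spheres. -/
def bdry (m : ℕ) : Set (DiscsSpheres m) := {s | ∃ i z, s = Sum.inl (i, z) ∧ ‖(z : ℂ)‖ = 1}

section

variable {N : Type*} [TopologicalSpace N] {m : ℕ}

/-- The map `D₁ ⊔ ⋯ ⊔ D_m ⊔ E₁ ⊔ ⋯ ⊔ E_m`. -/
def union (D : Fin m → C(Disc, N)) (E : Fin m → C(Sphere, N)) : DiscsSpheres m → N :=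
  Sum.elim (fun s => D s.1 s.2) (fun s => E s.1 s.2)

/-- The spheres `E` are geometrically dual to the discs `D`: for `i ≠ j`, `D i` and `E j` are
disjoint, and `D i` and `E i` meet in precisely one point. (Transversality of this intersection is
part of the generic immersion condition for `D ⊔ E`.) -/
def IsGeometricallyDual (D : Fin m → C(Disc, N)) (E : Fin m → C(Sphere, N)) : Prop :=
  (∀ i j, i ≠ j → Disjoint (Set.range (D i)) (Set.range (E j))) ∧
    ∀ i, ∃! q : Disc × Sphere, D i q.1 = E i q.2

variable [ChartedSpace (EuclideanHalfSpace 4) N] {D : Fin m → C(Disc, N)}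
  {E : Fin m → C(Sphere, N)}

/-- The open tubular neighbourhood `⋃ᵢ νDᵢ`: the image of the open unit disc bundles. -/
def tube (ν : FramedNormalBundle (bdry m) (union D E)) : Set N :=
  {p | ∃ (i : Fin m) (z : Disc) (y : ℂ), ‖y‖ < 1 ∧ ν.map (Sum.inl (i, z), y) = p}

/-- The exterior `N ∖ ⋃ᵢ νDᵢ`. -/
abbrev Exterior (ν : FramedNormalBundle (bdry m) (union D E)) : Type _ := {p : N // p ∉ tube ν}

/-- The inclusion `ι : N ∖ ⋃ᵢ νDᵢ → N`. -/
def incl (ν : FramedNormalBundle (bdry m) (union D E)) : C(Exterior ν, N) :=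
  ⟨Subtype.val, continuous_subtype_val⟩

/-- Data for tubing a meridional disc of the sheet through `s` (a sheet of `D i`) at a double point
with plumbing `P` into a parallel copy of the dual sphere `E i`, together with parallel copies
of the result, indexed by `τ ∈ [-1, 1]`:
* `dual` is the plumbing at the intersection point of `D i` and `E i`;
* `arc (·, τ)` are parallel arcs in `D i`, forming an embedded band, from the point
  `u (r e^{iτ·width} base)` of `D i` to the point where `D i` meets the parallel copy
  `E i × {copy τ}` of `E i`;
* `ρ` is the radius of the tube, the circle bundle over the arc;
* `punctured` parametrises, by a disc, `E i` without the open disc of radius `ρ` around the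
  intersection point with `D i`. -/
structure MeridionalTubing (ν : FramedNormalBundle (bdry m) (union D E)) {s t : DiscsSpheres m}
    (P : Plumbing ν.map s t) (i : Fin m) (r : ℝ) (base : Circle) (width : ℝ) where
  a : Disc
  b : Sphere
  dual : Plumbing ν.map (Sum.inl (i, a)) (Sum.inr (i, b))
  ρ : ℝ
  one_le_ρ : 1 ≤ ρ
  ρ_le : ρ ≤ r
  arc : C(I × Par, Disc)
  arc_injective : Function.Injective arc
  copy : C(Par, ℂ)
  arc_zero : ∀ τ : Par,
    Sum.inl (i, arc (0, τ)) = P.u (r * (base * Circle.exp (width * τ) : Circle))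
  arc_one : ∀ τ : Par, Sum.inl (i, arc (1, τ)) = dual.u (copy τ)
  punctured : C(Disc, Sphere)
  punctured_injective : Function.Injective punctured
  punctured_range : ∀ z : Sphere,
    z ∈ Set.range punctured ↔ Sum.inr (i, z) ∉ dual.v '' Metric.ball 0 ρ
  punctured_boundary : ∀ ξ : Circle,
    Sum.inr (i, punctured (circleToDisc ξ)) = dual.v (ρ * ξ)

/-- The direction `z / |z|` of a point `z` of the disc with `|z| ≥ 1/3`. -/
def direction (z : Disc) : ℂ := z / (max (1 / 3) ‖(z : ℂ)‖ : ℝ)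

theorem direction_continuous : Continuous direction := by
  refine Continuous.div continuous_subtype_val (by fun_prop) fun z => ?_
  exact_mod_cast (lt_max_of_lt_left (by norm_num) : 0 < max (1 / 3) ‖(z : ℂ)‖).ne'

theorem norm_direction {z : Disc} (h : 1 / 3 ≤ ‖(z : ℂ)‖) : ‖direction z‖ = 1 := by
  have h0 : (0 : ℝ) < ‖(z : ℂ)‖ := lt_of_lt_of_le (by norm_num) h
  rw [direction, max_eq_right h, norm_div, Complex.norm_real, norm_norm, div_self h0.ne']

namespace MeridionalTubing

variable {ν : FramedNormalBundle (bdry m) (union D E)} {s t : DiscsSpheres m}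
  {P : Plumbing ν.map s t} {i : Fin m} {r : ℝ} {base : Circle} {width : ℝ}
  (T : MeridionalTubing ν P i r base width)

/-- The outer ring of the cap: the part of the meridional disc of radius `r`, the fibre over
`u (r e^{iτ·width} base)`, outside the disc of radius `ρ`. -/
def meridianPart (z : Disc) (τ : Par) : N :=
  ν.map (P.u (r * (base * Circle.exp (width * τ) : Circle)),
    ((T.ρ + (3 * ‖(z : ℂ)‖ - 2) * (r - T.ρ) : ℝ) : ℂ) * direction z)

/-- The middle ring of the cap: the tube of radius `ρ` along the arc. -/
def tubePart (z : Disc) (τ : Par) : N :=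
  ν.map (Sum.inl (i, T.arc (Set.projIcc 0 1 zero_le_one (2 - 3 * ‖(z : ℂ)‖), τ)),
    (T.ρ : ℂ) * direction z)

/-- The centre of the cap: the punctured parallel copy of the dual sphere. -/
def spherePart (z : Disc) (τ : Par) : N :=
  ν.map (Sum.inr (i, T.punctured (toDisc (3 * z))), T.copy τ)

/-- The cap (for `τ = 0`), and its parallel copies. -/
def capFun (q : Disc × Par) : N :=
  if ‖(q.1 : ℂ)‖ ≤ 1 / 3 then T.spherePart q.1 q.2
  else if ‖(q.1 : ℂ)‖ ≤ 2 / 3 then T.tubePart q.1 q.2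
  else T.meridianPart q.1 q.2

theorem capFun_continuous : Continuous T.capFun := by
  have hm := ν.isLocalHomeomorph.continuous
  have hn : Continuous fun q : Disc × Par => ‖(q.1 : ℂ)‖ :=
    (continuous_subtype_val.comp continuous_fst).norm
  have hd : Continuous fun q : Disc × Par => direction q.1 :=
    direction_continuous.comp continuous_fst
  refine Continuous.if_le ?_ (Continuous.if_le ?_ ?_ hn continuous_const ?_) hn continuous_const ?_
  · refine hm.comp (Continuous.prodMk (continuous_inr.comp (continuous_const.prodMk
      (T.punctured.continuous.comp (toDisc_continuous.comp (continuous_const.mul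
        (continuous_subtype_val.comp continuous_fst)))))) (T.copy.continuous.comp continuous_snd))
  · refine hm.comp (Continuous.prodMk (continuous_inl.comp (continuous_const.prodMk
      (T.arc.continuous.comp (Continuous.prodMk ?_ continuous_snd)))) (continuous_const.mul hd))
    exact continuous_projIcc.comp (continuous_const.sub (continuous_const.mul hn))
  · refine hm.comp (Continuous.prodMk (P.u_embedding.continuous.comp
      (continuous_const.mul (continuous_subtype_val.comp (continuous_const.mul
        (Circle.exp.continuous.comp (continuous_const.mul
          (continuous_subtype_val.comp continuous_snd)))))))
      (Continuous.mul (Complex.continuous_ofReal.comp ?_) hd))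
    exact continuous_const.add (((continuous_const.mul hn).sub continuous_const).mul
      continuous_const)
  · intro q hq
    have e : Set.projIcc (0 : ℝ) 1 zero_le_one (2 - 3 * ‖(q.1 : ℂ)‖) = 0 :=
      Set.projIcc_of_le_left _ (by rw [hq]; norm_num)
    rw [tubePart, meridianPart, e, T.arc_zero, hq]
    norm_num
  · intro q hq
    have e : Set.projIcc (0 : ℝ) 1 zero_le_one (2 - 3 * ‖(q.1 : ℂ)‖) = 1 :=
      Set.projIcc_of_right_le _ (by rw [hq]; norm_num)
    have hξ : (3 : ℂ) * q.1 = direction q.1 := by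
      rw [direction, hq, max_self]; push_cast; ring
    let ξ : Circle := ⟨direction q.1, mem_sphere_zero_iff_norm.2 (norm_direction hq.ge)⟩
    have hx : toDisc (3 * (q.1 : ℂ)) = circleToDisc ξ := by rw [hξ]; exact toDisc_circle ξ
    rw [if_pos (by rw [hq]; norm_num), spherePart, tubePart, hx, T.punctured_boundary, e, T.arc_one,
      T.dual.plumb]

/-- The cap with its parallel copies, as a map to `N`. -/
def cap : C(Disc × Par, N) := ⟨T.capFun, T.capFun_continuous⟩

theorem cap_boundary (ξ : Circle) (τ : Par) : T.cap (circleToDisc ξ, τ) =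
    ν.map (P.u (r * (base * Circle.exp (width * τ) : Circle)), r * ξ) := by
  have hn : ‖((circleToDisc ξ : Disc) : ℂ)‖ = 1 := Circle.norm_coe ξ
  have hd : direction (circleToDisc ξ) = ξ := by
    rw [direction, hn]; norm_num [circleToDisc]
  change T.capFun _ = _
  rw [capFun, if_neg, if_neg, meridianPart, hd]
  · simp only [hn]
    congr 3
    norm_num
  · simp only [hn]; norm_num
  · simp only [hn]; norm_num

end MeridionalTubing

/-- The Clifford torus of radius `r` at a double point with plumbing `P`: the product of the circles
of radius `r` in the two sheets. -/
def cliffordTorus {ν : FramedNormalBundle (bdry m) (union D E)} {s t : DiscsSpheres m}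
    (P : Plumbing ν.map s t) (r : ℝ) : C(Circle × Circle, N) :=
  ⟨fun q => ν.map (P.u (r * q.1), r * q.2), ν.isLocalHomeomorph.continuous.comp
    ((P.u_embedding.continuous.comp (continuous_const.mul
      (continuous_subtype_val.comp continuous_fst))).prodMk
        (continuous_const.mul (continuous_subtype_val.comp continuous_snd)))⟩

/-- A Clifford torus of radius at least `1` lies in the exterior of the tubular neighbourhood. -/
theorem cliffordTorus_notMem {ν : FramedNormalBundle (bdry m) (union D E)} {s t : DiscsSpheres m}
    (P : Plumbing ν.map s t) {r : ℝ} (hr : 1 ≤ r) (q : Circle × Circle) :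
    cliffordTorus P r q ∉ tube ν := by
  rintro ⟨k, z, y, hy, h⟩
  have hn : ∀ ξ : Circle, ‖(r * ξ : ℂ)‖ = r := fun ξ => by
    rw [norm_mul, Circle.norm_coe, mul_one, Complex.norm_real, Real.norm_of_nonneg (by linarith)]
  have h2 := ν.encard_preimage_le (cliffordTorus P r q)
  have hsub : ({(P.u (r * q.1), (r * q.2 : ℂ)), (P.v (r * q.2), (r * q.1 : ℂ)),
      (Sum.inl (k, z), y)} : Set (DiscsSpheres m × ℂ)) ⊆ ν.map ⁻¹' {cliffordTorus P r q} := by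
    rintro p (rfl | rfl | rfl)
    · rfl
    · exact (P.plumb _ _).symm
    · exact h
  have h3 := (Set.encard_le_encard hsub).trans h2
  rw [Set.encard_insert_of_notMem, Set.encard_pair] at h3
  · norm_num at h3
  · intro e
    have := congrArg (fun p => ‖p.2‖) e
    simp only [hn] at this
    linarith
  · rintro (e | e)
    · exact Set.disjoint_left.1 P.disjoint ⟨_, rfl⟩ ⟨_, (congrArg Prod.fst e).symm⟩
    · have := congrArg (fun p => ‖p.2‖) e
      simp only [hn] at this
      linarith

/-- The capped surface in `N ∖ ⋃ᵢ νDᵢ` whose body is the Clifford torus of radius `r` at a double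
point with plumbing `P`, between `D i` and `D j`, and whose caps are meridional discs
tubed into parallel copies of `E i` and `E j`. -/
def cliffordCappedTorus {ν : FramedNormalBundle (bdry m) (union D E)} {i j : Fin m} {a b : Disc}
    {P : Plumbing ν.map (Sum.inl (i, a)) (Sum.inl (j, b))} {r : ℝ} (hr : 1 ≤ r)
    {base₁ base₂ : Circle} {width₁ width₂ : ℝ}
    (hw₁ : width₁ ∈ Set.Ioo 0 Real.pi) (hw₂ : width₂ ∈ Set.Ioo 0 Real.pi)
    (T₁ : MeridionalTubing ν P i r base₁ width₁) (T₂ : MeridionalTubing ν P.swap j r base₂ width₂)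
    (h₁ : ∀ q, T₁.cap q ∉ tube ν) (h₂ : ∀ q, T₂.cap q ∉ tube ν) :
    CappedTorus (Exterior ν) where
  body := ⟨fun q => ⟨cliffordTorus P r q, cliffordTorus_notMem P hr q⟩,
    (cliffordTorus P r).continuous.subtype_mk _⟩
  base₁ := base₁
  base₂ := base₂
  width₁ := width₁
  width₂ := width₂
  width₁_mem := hw₁
  width₂_mem := hw₂
  cap₁ := ⟨fun q => ⟨T₁.cap q, h₁ q⟩, T₁.cap.continuous.subtype_mk _⟩
  cap₂ := ⟨fun q => ⟨T₂.cap q, h₂ q⟩, T₂.cap.continuous.subtype_mk _⟩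
  cap₁_boundary ξ τ := Subtype.ext (T₁.cap_boundary ξ τ)
  cap₂_boundary ζ τ := Subtype.ext ((T₂.cap_boundary ζ τ).trans (P.plumb _ _).symm)

end

end
end CappedSurface

/-!
In `N`, where the sheets of the discs may be crossed, the Clifford torus `{|x| = |y| = r}` is
null-homotopic: it contracts to the double point within the plumbing coordinates
(`nullhomotopic_cliffordTorus`). This alone forces the contraction to be null-homotopic, whatever
the caps are: for any capped torus in any space, if the body is null-homotopic, then so is the
contraction (`CappedTorus.nullhomotopic_contraction`).

Indeed, dragging the caps along with the null-homotopy of the body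
(`CappedTorus.exists_homotopic_contraction`) reduces this to the case of a constant body. The copies
of the two caps are then spheres `A_t` and `B_t` based at one point, and the contraction, read around
the four side faces `x = 1`, `y = 1`, `x = -1`, `y = -1` of the cube, is the sum of `A_1`, `B_1`,
`-A_{-1}` and `-B_{-1}`. As `A_1 ≃ A_{-1}` and `B_1 ≃ B_{-1}`, this is a commutator in `π₂`, and it
vanishes by the Eckmann–Hilton argument: slide the copies of the first cap to the upper half of the
cube and those of the second cap to the lower half (`CappedTorus.slidContraction`), and fill the two
halves of the solid cube with the families `A_t` and `B_t` (`CappedTorus.cubeFilling`).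

Finally, a freely null-homotopic sphere represents the trivial element of `π₂` for every base point
and whisker (`sphereClass_eq_one_of_nullhomotopic`).
-/

namespace CappedSurface

noncomputable section

variable {X Y : Type*} [TopologicalSpace X] [TopologicalSpace Y]

/-! ### Extending homotopies from the circle to the disc -/

/-- The point `z / |z|` of the unit circle, with the junk value `1` at `z = 0`. -/
def toCircle (z : ℂ) : Circle :=
  if h : z = 0 then 1 else ⟨z / (‖z‖ : ℝ), mem_sphere_zero_iff_norm.2 <| by
    rw [norm_div, Complex.norm_real, norm_norm, div_self (norm_ne_zero_iff.2 h)]⟩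

theorem coe_toCircle {z : ℂ} (h : z ≠ 0) : (toCircle z : ℂ) = z / (‖z‖ : ℝ) :=
  congrArg (fun ξ : Circle => (ξ : ℂ)) (dif_neg h)

theorem toCircle_coe (ξ : Circle) : toCircle ξ = ξ := by
  apply Circle.ext
  rw [coe_toCircle (Circle.coe_ne_zero ξ), Circle.norm_coe, Complex.ofReal_one, div_one]

theorem continuousOn_toCircle : ContinuousOn toCircle {0}ᶜ := by
  have hi : Topology.IsInducing fun ξ : Circle => (ξ : ℂ) := ⟨rfl⟩
  rw [hi.continuousOn_iff]
  refine ContinuousOn.congr (f := fun z : ℂ => z / (‖z‖ : ℝ)) ?_ fun z hz => coe_toCircle hz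
  refine continuousOn_id.div (by fun_prop) fun z hz => ?_
  exact_mod_cast norm_ne_zero_iff.2 hz

/-- The homotopy extension property of the pair `(D², S¹)`, with a parameter space `Y`: at time `s`
the disc of radius `1 / (1 + s)` carries a rescaled copy of `f`, and the collar around it carries
the track of the homotopy `h` up to time `s`. -/
theorem exists_homotopy_extension (f : C(Disc × Y, X)) (h : C(I × Circle × Y, X))
    (h_zero : ∀ ξ y, h (0, ξ, y) = f (circleToDisc ξ, y)) :
    ∃ H : C(I × Disc × Y, X), (∀ q, H (0, q) = f q) ∧
      ∀ s ξ y, H (s, circleToDisc ξ, y) = h (s, ξ, y) := by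
  let ρ : I × Disc × Y → ℝ := fun q => (1 + (q.1 : ℝ)) * ‖(q.2.1 : ℂ)‖
  have hρ : Continuous ρ := by fun_prop
  let inner : I × Disc × Y → X := fun q => f (toDisc ((1 + (q.1 : ℝ) : ℝ) * (q.2.1 : ℂ)), q.2.2)
  let outer : I × Disc × Y → X := fun q =>
    h (Set.projIcc 0 1 zero_le_one (ρ q - 1), toCircle q.2.1, q.2.2)
  have norm_inner : ∀ q : I × Disc × Y, ‖(((1 + (q.1 : ℝ) : ℝ) : ℂ) * (q.2.1 : ℂ))‖ = ρ q :=
    fun q => by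
      rw [norm_mul, Complex.norm_real, Real.norm_of_nonneg (add_nonneg zero_le_one q.1.2.1)]
  have ne_zero : ∀ q : I × Disc × Y, 1 ≤ ρ q → (q.2.1 : ℂ) ≠ 0 := fun q hq h0 => by
    simp only [ρ, h0, norm_zero, mul_zero] at hq
    norm_num at hq
  refine ⟨⟨fun q => if ρ q ≤ 1 then inner q else outer q, ?_⟩, fun q => ?_, fun s ξ y => ?_⟩
  · refine continuous_if_le hρ continuous_const (Continuous.continuousOn ?_) ?_ fun q hq => ?_
    · exact f.continuous.comp ((toDisc_continuous.comp (by fun_prop)).prodMk (by fun_prop))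
    · refine h.continuous.comp_continuousOn (ContinuousOn.prodMk ?_ (ContinuousOn.prodMk ?_ ?_))
      · exact (continuous_projIcc.comp (hρ.sub continuous_const)).continuousOn
      · exact continuousOn_toCircle.comp (Continuous.continuousOn (by fun_prop)) ne_zero
      · exact Continuous.continuousOn (by fun_prop)
    · have hz := ne_zero q hq.ge
      have e : Set.projIcc (0 : ℝ) 1 zero_le_one (ρ q - 1) = 0 :=
        Set.projIcc_of_le_left _ (by rw [hq]; norm_num)
      simp only [inner, outer]
      rw [e, h_zero]
      congr 2
      apply Subtype.ext
      rw [toDisc_coe ((norm_inner q).trans hq).le]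
      change _ = (toCircle _ : ℂ)
      rw [coe_toCircle hz, eq_div_iff (by exact_mod_cast norm_ne_zero_iff.2 hz), mul_right_comm,
        ← Complex.ofReal_mul]
      change ((ρ q : ℝ) : ℂ) * _ = _
      rw [hq, Complex.ofReal_one, one_mul]
  · have hq : ‖(q.1 : ℂ)‖ ≤ 1 := mem_closedBall_zero_iff.1 q.1.2
    have e : ρ (0, q) = ‖(q.1 : ℂ)‖ := by simp [ρ]
    simp only [ContinuousMap.coe_mk]
    rw [if_pos (e.trans_le hq)]
    simp only [inner]
    congr 1
    refine Prod.ext (Subtype.ext ?_) rfl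
    rw [toDisc_coe (by simpa using hq)]
    simp
  · have e : ρ (s, circleToDisc ξ, y) = 1 + s := by
      change (1 + (s : ℝ)) * ‖(ξ : ℂ)‖ = _
      rw [Circle.norm_coe, mul_one]
    have o : outer (s, circleToDisc ξ, y) = h (s, ξ, y) := by
      simp only [outer, e, add_sub_cancel_left, Set.projIcc_val]
      rw [show ((circleToDisc ξ : Disc) : ℂ) = ξ from rfl, toCircle_coe]
    simp only [ContinuousMap.coe_mk]
    split_ifs with hs
    · have hs0 : s = 0 := Subtype.ext (le_antisymm (by rw [e] at hs; simpa using hs) s.2.1)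
      subst hs0
      rw [h_zero]
      simp only [inner]
      rw [Set.Icc.coe_zero, add_zero, Complex.ofReal_one, one_mul]
      exact congrArg (fun z => f (z, y)) (toDisc_circle ξ)
    · exact o

/-! ### Deforming the body of a capped torus to a point -/

namespace CappedTorus

/-- The image of a capped torus under a continuous map. -/
def map (φ : C(X, Y)) (K : CappedTorus X) : CappedTorus Y where
  body := φ.comp K.body
  base₁ := K.base₁
  base₂ := K.base₂
  width₁ := K.width₁
  width₂ := K.width₂
  width₁_mem := K.width₁_mem
  width₂_mem := K.width₂_mem
  cap₁ := φ.comp K.cap₁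
  cap₂ := φ.comp K.cap₂
  cap₁_boundary ξ t := congrArg φ (K.cap₁_boundary ξ t)
  cap₂_boundary ζ t := congrArg φ (K.cap₂_boundary ζ t)

theorem map_contraction (φ : C(X, Y)) (K : CappedTorus X) :
    (K.map φ).contraction = φ.comp K.contraction := by
  ext p
  simp only [contraction, ContinuousMap.comp_apply, ContinuousMap.coe_mk, cubeContraction]
  split_ifs <;> rfl

/-- A null-homotopy of the body drags the caps along, which deforms the contraction to that of a
capped torus with constant body. -/
theorem exists_homotopic_contraction (K : CappedTorus X) {x₀ : X}
    (h : K.body.Homotopic (.const _ x₀)) :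
    ∃ L : CappedTorus X, L.body = .const _ x₀ ∧ K.contraction.Homotopic L.contraction := by
  obtain ⟨h⟩ := h
  obtain ⟨H₁, H₁_zero, H₁_circle⟩ := exists_homotopy_extension K.cap₁
    ((h : C(I × Circle × Circle, X)).comp ⟨fun q : I × Circle × Par =>
      (q.1, K.base₁ * Circle.exp (K.width₁ * q.2.2), q.2.1), by fun_prop⟩)
    fun ξ t => by simp [K.cap₁_boundary]
  obtain ⟨H₂, H₂_zero, H₂_circle⟩ := exists_homotopy_extension K.cap₂
    ((h : C(I × Circle × Circle, X)).comp ⟨fun q : I × Circle × Par =>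
      (q.1, q.2.1, K.base₂ * Circle.exp (K.width₂ * q.2.2)), by fun_prop⟩)
    fun ξ t => by simp [K.cap₂_boundary]
  -- A homotopy of capped tori is a capped torus in the path space `C(I, X)`; its contraction is
  -- then a homotopy of contractions.
  let M : CappedTorus C(I, X) :=
    { K with
      body := ((h : C(I × Circle × Circle, X)).comp .prodSwap).curry
      cap₁ := (H₁.comp .prodSwap).curry
      cap₂ := (H₂.comp .prodSwap).curry
      cap₁_boundary := fun ξ t => by
        ext s
        exact H₁_circle s ξ t
      cap₂_boundary := fun ξ t => by
        ext s
        exact H₂_circle s ξ t }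
  let ev : I → C(C(I, X), X) := fun s => ⟨fun γ => γ s, continuous_eval_const s⟩
  have M_zero : M.map (ev 0) = K := by
    have e : (M.map (ev 0)).body = K.body := by ext q; exact h.apply_zero q
    have e₁ : (M.map (ev 0)).cap₁ = K.cap₁ := by ext q; exact H₁_zero q
    have e₂ : (M.map (ev 0)).cap₂ = K.cap₂ := by ext q; exact H₂_zero q
    cases K
    simp only [map] at e e₁ e₂ ⊢
    simp only [e, e₁, e₂, M]
  refine ⟨M.map (ev 1), ?_, ⟨⟨⟨fun q => M.contraction q.2 q.1, ?_⟩, fun p => ?_, fun p => ?_⟩⟩⟩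
  · ext q
    exact h.apply_one q
  · exact M.contraction.continuous.comp continuous_snd |>.eval continuous_fst
  · change ev 0 (M.contraction p) = _
    rw [← ContinuousMap.comp_apply, ← map_contraction, M_zero]
  · change ev 1 (M.contraction p) = _
    rw [← ContinuousMap.comp_apply, ← map_contraction]

/-! ### The contraction of a capped torus with constant body -/

theorem continuous_capFace₁ (K : CappedTorus X) {Z : Type*} [TopologicalSpace Z] {x y z : Z → ℝ}
    (hx : Continuous x) (hy : Continuous y) (hz : Continuous z) :
    Continuous fun q => K.capFace₁ (x q) (y q) (z q) :=
  K.cap₁.continuous.comp (((bigon_continuous _ _).comp (hy.prodMk hz)).prodMk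
    (toPar_continuous.comp hx))

theorem continuous_capFace₂ (K : CappedTorus X) {Z : Type*} [TopologicalSpace Z] {x y z : Z → ℝ}
    (hx : Continuous x) (hy : Continuous y) (hz : Continuous z) :
    Continuous fun q => K.capFace₂ (x q) (y q) (z q) :=
  K.cap₂.continuous.comp (((bigon_continuous _ _).comp (hx.prodMk hz)).prodMk
    (toPar_continuous.comp hy))

/-- If the body is constant, then each copy of the first cap is a map of the square `(y, z)` which
is constant on the boundary. Composing with `toPar` extends it to all `z`, constantly for
`|z| ≥ 1`. -/
theorem capFace₁_eq_of_body_eq_const {K : CappedTorus X} {x₀ : X} (hK : K.body = .const _ x₀)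
    (x : ℝ) {y z : ℝ} (h : |y| = 1 ∨ 1 ≤ |z|) : K.capFace₁ x y (toPar z) = x₀ := by
  have circle : ∀ ξ t, K.cap₁ (circleToDisc ξ, t) = x₀ := fun ξ t => by
    rw [K.cap₁_boundary, hK, ContinuousMap.const_apply]
  rw [capFace₁]
  rcases h with h | h
  · rw [bigon_vertex _ _ _ h, circle]
  · rcases le_abs'.1 h with h | h
    · rw [toPar, Set.projIcc_of_le_left _ h, bigon_near, circle]
    · rw [toPar, Set.projIcc_of_right_le _ h, bigon_far, circle]

theorem capFace₂_eq_of_body_eq_const {K : CappedTorus X} {x₀ : X} (hK : K.body = .const _ x₀)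
    {x : ℝ} (y : ℝ) {z : ℝ} (h : |x| = 1 ∨ 1 ≤ |z|) : K.capFace₂ x y (toPar z) = x₀ := by
  have circle : ∀ ξ t, K.cap₂ (circleToDisc ξ, t) = x₀ := fun ξ t => by
    rw [K.cap₂_boundary, hK, ContinuousMap.const_apply]
  rw [capFace₂]
  rcases h with h | h
  · rw [bigon_vertex _ _ _ h, circle]
  · rcases le_abs'.1 h with h | h
    · rw [toPar, Set.projIcc_of_le_left _ h, bigon_near, circle]
    · rw [toPar, Set.projIcc_of_right_le _ h, bigon_far, circle]

/-- The map on the surface of the cube given by the copies of the first cap, supported in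
`-(1 - s) / (1 + s) ≤ z ≤ 1`, on the region `|y| ≤ |x|` and by the copies of the second cap,
supported in `-1 ≤ z ≤ (1 - s) / (1 + s)`, on the remaining region. As `s` runs from `0` to `1`,
the first caps slide to the upper half and the second caps to the lower half. -/
def slidContraction (K : CappedTorus X) (s x y z : ℝ) : X :=
  if |y| ≤ |x| then K.capFace₁ x y (toPar ((1 + s) * z - s))
  else K.capFace₂ x y (toPar ((1 + s) * z + s))

/-- If the body is constant, this is an extension of `slidContraction K 1` to the solid cube: in the
upper half, the family of all parallel copies of the first cap, stacked in the direction `x`; in the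
lower half, that of the second cap, stacked in the direction `y`. -/
def cubeFilling (K : CappedTorus X) (q : ℝ × ℝ × ℝ) : X :=
  if 0 ≤ q.2.2 then K.capFace₁ q.1 q.2.1 (toPar (2 * q.2.2 - 1))
  else K.capFace₂ q.1 q.2.1 (toPar (2 * q.2.2 + 1))

theorem cubeFilling_continuous {K : CappedTorus X} {x₀ : X} (hK : K.body = .const _ x₀) :
    Continuous K.cubeFilling := by
  have ht := continuous_subtype_val.comp toPar_continuous
  refine Continuous.if_le ?_ ?_ continuous_const (by fun_prop) fun q hq => ?_
  · exact K.continuous_capFace₁ (by fun_prop) (by fun_prop) (ht.comp (by fun_prop))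
  · exact K.continuous_capFace₂ (by fun_prop) (by fun_prop) (ht.comp (by fun_prop))
  · rw [← hq, capFace₁_eq_of_body_eq_const hK _ (by norm_num),
      capFace₂_eq_of_body_eq_const hK _ (by norm_num)]

theorem slidContraction_zero {K : CappedTorus X} {x₀ : X} (hK : K.body = .const _ x₀)
    {x y z : ℝ} (h : max |x| (max |y| |z|) = 1) :
    K.slidContraction 0 x y z = K.cubeContraction x y z := by
  have hz : |z| ≤ 1 := ((le_max_right _ _).trans (le_max_right _ _)).trans h.le
  have flat : 1 ≤ |z| → K.slidContraction 0 x y z = x₀ := fun h1 => by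
    rw [slidContraction, add_zero, one_mul, sub_zero, add_zero,
      capFace₁_eq_of_body_eq_const hK _ (.inr h1), capFace₂_eq_of_body_eq_const hK _ (.inr h1),
      ite_self]
  have hz1 : max |x| |y| ≤ |z| → 1 ≤ |z| := fun h1 => by
    rw [← max_assoc, max_eq_right h1] at h
    exact h.ge
  -- The contraction is constant on the top and bottom faces, where `slidContraction` is `x₀` too.
  rw [cubeContraction]
  split_ifs with h1 h2 h3
  · rw [flat (hz1 (h1.trans (neg_le_abs z))), nearSquare, hK, ContinuousMap.const_apply]
  · rw [flat (hz1 (h2.trans (le_abs_self z))), farSquare, hK, ContinuousMap.const_apply]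
  · rw [slidContraction, if_pos h3, add_zero, one_mul, sub_zero, toPar_coe hz]
  · rw [slidContraction, if_neg h3, add_zero, add_zero, one_mul, toPar_coe hz]

theorem slidContraction_one {K : CappedTorus X} {x₀ : X} (hK : K.body = .const _ x₀)
    {x y z : ℝ} (h : max |x| (max |y| |z|) = 1) :
    K.slidContraction 1 x y z = K.cubeFilling (x, y, z) := by
  -- If `z` has the wrong sign for the cap carried by the face, both sides are equal to `x₀`.
  have e : (1 + 1) * z = 2 * z := by norm_num
  simp only [slidContraction, cubeFilling, e]
  split_ifs with h1 h2 h2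
  · rfl
  · rw [capFace₁_eq_of_body_eq_const hK _ (.inr (le_abs.2 (.inr (by linarith)))),
      capFace₂_eq_of_body_eq_const hK]
    rw [← max_assoc, max_eq_left h1] at h
    rcases max_choice |x| |z| with e | e
    · exact .inl (e ▸ h)
    · rw [e, abs_of_neg (not_le.1 h2)] at h
      exact .inr (le_abs.2 (.inr (by linarith)))
  · rw [capFace₂_eq_of_body_eq_const hK _ (.inr (le_abs.2 (.inl (by linarith)))),
      capFace₁_eq_of_body_eq_const hK]
    rw [← max_assoc, max_eq_right (not_le.1 h1).le] at h
    rcases max_choice |y| |z| with e | e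
    · exact .inl (e ▸ h)
    · rw [e, abs_of_nonneg h2] at h
      exact .inr (le_abs.2 (.inl (by linarith)))
  · rfl

theorem slidContraction_continuous {K : CappedTorus X} {x₀ : X} (hK : K.body = .const _ x₀) :
    Continuous fun q : I × Sphere =>
      K.slidContraction q.1 (cubeCoord q.2 0) (cubeCoord q.2 1) (cubeCoord q.2 2) := by
  have c : ∀ k, Continuous fun q : I × Sphere => cubeCoord q.2 k := fun k =>
    (cubeCoord_continuous k).comp continuous_snd
  have c0 := c 0
  have c1 := c 1
  have c2 := c 2
  have ht := continuous_subtype_val.comp toPar_continuous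
  refine Continuous.if_le ?_ ?_ c1.abs c0.abs fun q hq => ?_
  · exact K.continuous_capFace₁ c0 c1 (ht.comp (by fun_prop))
  · exact K.continuous_capFace₂ c0 c1 (ht.comp (by fun_prop))
  · have s0 := q.1.2.1
    have hn := cubeCoord_norm q.2
    rw [← max_assoc, ← hq, max_self] at hn
    rcases max_choice |cubeCoord q.2 1| |cubeCoord q.2 2| with e | e
    · rw [e] at hn
      rw [capFace₁_eq_of_body_eq_const hK _ (.inl hn),
        capFace₂_eq_of_body_eq_const hK _ (.inl (hq ▸ hn))]
    · rw [e] at hn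
      rw [capFace₁_eq_of_body_eq_const hK _ (.inr ?_), capFace₂_eq_of_body_eq_const hK _ (.inr ?_)]
      all_goals
        rcases (abs_eq zero_le_one).1 hn with h | h
        · rw [h]; exact le_abs.2 (.inl (by linarith))
        · rw [h]; exact le_abs.2 (.inr (by linarith))

theorem nullhomotopic_contraction_of_body_eq_const {K : CappedTorus X} {x₀ : X}
    (hK : K.body = .const _ x₀) : K.contraction.Nullhomotopic := by
  let coords : C(Sphere, ℝ × ℝ × ℝ) :=
    ⟨fun p => (cubeCoord p 0, cubeCoord p 1, cubeCoord p 2), (cubeCoord_continuous 0).prodMk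
      ((cubeCoord_continuous 1).prodMk (cubeCoord_continuous 2))⟩
  let G : C(ℝ × ℝ × ℝ, X) := ⟨K.cubeFilling, cubeFilling_continuous hK⟩
  obtain ⟨x₁, h⟩ := ((id_nullhomotopic (ℝ × ℝ × ℝ)).comp_right G).comp_left coords
  refine ⟨x₁, ContinuousMap.Homotopic.trans ⟨⟨⟨_, slidContraction_continuous hK⟩, fun p => ?_,
    fun p => ?_⟩⟩ h⟩
  · exact slidContraction_zero hK (cubeCoord_norm p)
  · exact slidContraction_one hK (cubeCoord_norm p)

theorem nullhomotopic_contraction {K : CappedTorus X} (hK : K.body.Nullhomotopic) :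
    K.contraction.Nullhomotopic := by
  obtain ⟨x₀, h⟩ := hK
  obtain ⟨L, hL, hKL⟩ := K.exists_homotopic_contraction h
  obtain ⟨x₁, h₁⟩ := nullhomotopic_contraction_of_body_eq_const hL
  exact ⟨x₁, hKL.trans h₁⟩

end CappedTorus

/-! ### Null-homotopic spheres and the second homotopy group -/

/-- The class of a freely null-homotopic sphere is trivial, for every whisker. The loop is first
deformed along the null-homotopy `H`, the whisker being prolonged by the track of the base point
under `H`; this ends with a loop that depends only on `sqRadius` and runs along the prolonged
whisker, along which it is then retracted. -/
theorem sphereClass_eq_one_of_nullhomotopic {S : C(Sphere, X)} (hS : S.Nullhomotopic) {x₀ : X}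
    (w : Path x₀ (S north)) : sphereClass S w = 1 := by
  obtain ⟨x₁, ⟨H⟩⟩ := hS
  -- The prolonged whisker: `w` on `[0, 1]`, then the track of the base point on `[1, 2]`.
  let W : ℝ → X := fun u =>
    if u ≤ 1 then w.extend u else H (Set.projIcc 0 1 zero_le_one (u - 1), north)
  have hW : Continuous W := by
    refine Continuous.if_le w.continuous_extend ?_ continuous_id continuous_const ?_
    · exact H.continuous.comp
        ((continuous_projIcc.comp (continuous_id.sub continuous_const)).prodMk continuous_const)
    · rintro _ rfl
      rw [sub_self, Set.projIcc_left, w.extend_one]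
      exact (H.apply_zero north).symm
  have W_zero : W 0 = x₀ := by simp [W]
  have W_add : ∀ t : I, W (1 + t) = H (t, north) := fun t => by
    simp only [W, add_sub_cancel_left, Set.projIcc_val]
    split_ifs with h
    · have ht : t = 0 := Subtype.ext (le_antisymm (by simpa using h) t.2.1)
      rw [ht]
      simp
    · rfl
  have W_two : ∀ u, 2 ≤ u → W u = x₁ := fun u hu => by
    simp only [W]
    rw [if_neg (by linarith), Set.projIcc_of_right_le _ (by linarith)]
    exact H.apply_one north
  let sq : (Fin 2 → I) → Sphere := fun c =>
    collapse (toPar (2 * sqCoord c 0)) (toPar (2 * sqCoord c 1))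
  have hsq : Continuous sq := collapse_continuous.comp (g := fun p : Par × Par => _)
    (f := fun c => (toPar (2 * sqCoord c 0), toPar (2 * sqCoord c 1)))
    ((toPar_continuous.comp (continuous_const.mul (sqCoord_continuous 0))).prodMk
      (toPar_continuous.comp (continuous_const.mul (sqCoord_continuous 1))))
  have sq_north : ∀ c, sqRadius c = 1 / 2 → sq c = north := fun c hc => by
    have h0 : |sqCoord c 0| ≤ 1 / 2 := (le_max_left _ _).trans hc.le
    have h1 : |sqCoord c 1| ≤ 1 / 2 := (le_max_right _ _).trans hc.le
    apply collapse_boundary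
    rw [toPar_coe (by rw [abs_mul, abs_two]; linarith),
      toPar_coe (by rw [abs_mul, abs_two]; linarith), abs_mul, abs_mul, abs_two]
    rw [sqRadius] at hc
    rcases max_choice |sqCoord c 0| |sqCoord c 1| with h | h
    · left; linarith
    · right; linarith
  have hR := sqRadius_continuous
  let L : C(I × (Fin 2 → I), X) := ⟨fun q =>
    if sqRadius q.2 ≤ 1 / 2 then H (q.1, sq q.2) else W ((1 + q.1) * (2 - 2 * sqRadius q.2)), by
      refine Continuous.if_le ?_ (hW.comp (by fun_prop)) (hR.comp continuous_snd)
        continuous_const fun q hq => ?_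
      · exact H.continuous.comp (continuous_fst.prodMk (hsq.comp continuous_snd))
      · rw [hq, sq_north _ hq, ← W_add]
        norm_num⟩
  let L' : C(I × (Fin 2 → I), X) :=
    ⟨fun q => W ((1 - q.1) * (4 - 4 * sqRadius q.2)), hW.comp (by fun_prop)⟩
  have L_boundary : ∀ t, ∀ c ∈ Cube.boundary (Fin 2), L (t, c) = x₀ := fun t c hc => by
    simp only [L, ContinuousMap.coe_mk, sqRadius_boundary hc]
    norm_num [W_zero]
  have L'_boundary : ∀ t, ∀ c ∈ Cube.boundary (Fin 2), L' (t, c) = x₀ := fun t c hc => by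
    simp only [L', ContinuousMap.coe_mk, sqRadius_boundary hc]
    norm_num [W_zero]
  have L_zero : ∀ c, L (0, c) = sphereLoop S w c := fun c => by
    change _ = sphereLoopFun S w c
    simp only [L, ContinuousMap.coe_mk, sphereLoopFun]
    split_ifs with hc
    · exact H.apply_zero _
    · simp only [W, Set.Icc.coe_zero]
      rw [if_pos (by linarith)]
      norm_num
  have L_one : ∀ c, L (1, c) = L' (0, c) := fun c => by
    simp only [L, L', ContinuousMap.coe_mk, Set.Icc.coe_zero, Set.Icc.coe_one]
    split_ifs with hc
    · rw [W_two _ (by linarith)]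
      exact H.apply_one _
    · congr 1
      ring
  rw [HomotopyGroup.one_def]
  refine Quotient.sound (ContinuousMap.HomotopicRel.trans
    (g := L'.comp (.prodMk (.const _ 0) (.id _)))
    ⟨⟨⟨L, fun c => L_zero c, fun c => L_one c⟩, fun t c hc => ?_⟩⟩
    ⟨⟨⟨L', fun c => rfl, fun c => ?_⟩, fun t c hc => ?_⟩⟩)
  · exact (L_boundary t c hc).trans ((sphereLoop S w).2 c hc).symm
  · change W _ = x₀
    simp [W_zero]
  · exact (L'_boundary t c hc).trans (L'_boundary 0 c hc).symm

theorem inducedMap_sphereClass (φ : C(X, Y)) (S : C(Sphere, X)) {x₀ : X}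
    (w : Path x₀ (S north)) :
    inducedMap φ 2 x₀ (sphereClass S w) = sphereClass (φ.comp S) (w.map φ.continuous) := by
  refine congrArg (Quotient.mk _) (Subtype.ext (ContinuousMap.ext fun c => ?_))
  change φ (sphereLoopFun S w c) = sphereLoopFun (φ.comp S) (w.map φ.continuous) c
  simp only [sphereLoopFun]
  split_ifs <;> rfl

/-! ### Clifford tori -/

/-- In the ambient manifold the Clifford torus contracts to the double point through the plumbing
coordinates. -/
theorem nullhomotopic_cliffordTorus {N : Type*} [TopologicalSpace N] {m : ℕ}
    [ChartedSpace (EuclideanHalfSpace 4) N] {D : Fin m → C(Disc, N)} {E : Fin m → C(Sphere, N)}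
    {ν : FramedNormalBundle (bdry m) (union D E)} {s t : DiscsSpheres m}
    (P : Plumbing ν.map s t) (r : ℝ) : (cliffordTorus P r).Nullhomotopic := by
  let coords : C(Circle × Circle, ℂ × ℂ) := ⟨fun q => (r * q.1, r * q.2), by fun_prop⟩
  let polydisc : C(ℂ × ℂ, N) := ⟨fun q => ν.map (P.u q.1, q.2),
    ν.isLocalHomeomorph.continuous.comp
      ((P.u_embedding.continuous.comp continuous_fst).prodMk continuous_snd)⟩
  exact ((id_nullhomotopic (ℂ × ℂ)).comp_right polydisc).comp_left coords

end

end CappedSurface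

theorem mainTheorem11 {N : Type*} [TopologicalSpace N] [T2Space N] [SecondCountableTopology N]
    [ChartedSpace (EuclideanHalfSpace 4) N] {m : ℕ}
    (D : Fin m → C(CappedSurface.Disc, N)) (E : Fin m → C(CappedSurface.Sphere, N))
    (hDE : CappedSurface.IsGenericImmersion (CappedSurface.bdry m) (CappedSurface.union D E))
    (hdual : CappedSurface.IsGeometricallyDual D E)
    (ν : CappedSurface.FramedNormalBundle (CappedSurface.bdry m) (CappedSurface.union D E))
    (i j : Fin m) (a b : CappedSurface.Disc) (hab : (i, a) ≠ (j, b)) (hp : D i a = D j b)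
    (P : CappedSurface.Plumbing ν.map (Sum.inl (i, a)) (Sum.inl (j, b)))
    (r : ℝ) (hr : 1 ≤ r) (base₁ base₂ : Circle) (width₁ width₂ : ℝ)
    (hw₁ : width₁ ∈ Set.Ioo 0 Real.pi) (hw₂ : width₂ ∈ Set.Ioo 0 Real.pi)
    (T₁ : CappedSurface.MeridionalTubing ν P i r base₁ width₁)
    (T₂ : CappedSurface.MeridionalTubing ν P.swap j r base₂ width₂)
    (h₁ : ∀ q, T₁.cap q ∉ CappedSurface.tube ν) (h₂ : ∀ q, T₂.cap q ∉ CappedSurface.tube ν)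
    (S : C(CappedSurface.Sphere, CappedSurface.Exterior ν))
    (hS : S = (CappedSurface.cliffordCappedTorus hr hw₁ hw₂ T₁ T₂ h₁ h₂).contraction) :
    ((CappedSurface.incl ν).comp S).Nullhomotopic ∧
      ∀ (x₀ : CappedSurface.Exterior ν) (w : Path x₀ (S CappedSurface.north)),
        CappedSurface.inducedMap (CappedSurface.incl ν) 2 x₀ (CappedSurface.sphereClass S w) = 1 :=
  by
  have null : ((CappedSurface.incl ν).comp S).Nullhomotopic := by
    rw [hS, ← CappedSurface.CappedTorus.map_contraction]
    exact CappedSurface.CappedTorus.nullhomotopic_contraction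
      (CappedSurface.nullhomotopic_cliffordTorus P r)
  refine ⟨null, fun x₀ w => ?_⟩
  rw [CappedSurface.inducedMap_sphereClass]
  exact CappedSurface.sphereClass_eq_one_of_nullhomotopic null _
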